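/- **Setting.** Let $0<\alpha<1$, $\varsigma=\alpha/2$, $m>0$, $\varepsilon>0$, $L>0$, let $M\ge 1$ be an integer and $h=L/M$. Let $\mathbb V_h$ be the space of real grid functions $v=(v_{i,j})$ that are $M$-periodic in $i$ and in $j$, with $\|v\|_\infty=\max_{i,j}|v_{i,j}|$, $\langle v,w\rangle=h^2\sum_{i,j=1}^M v_{i,j}w_{i,j}$ and $$\Delta_h v_{i,j}=h^{-2}\,(v_{i+1,j}+v_{i-1,j}+v_{i,j+1}+v_{i,j-1}-4v_{i,j}).$$ *Potential.* Let $\beta>0$ and let $D\subseteq\mathbb R$ be an open set containing $[-\beta,\beta]$ (the domain of $f$). Let $F:D\to\mathbb R$ be differentiable with $f=-F'$ continuously differentiable on $D$, $f(\beta)=f(-\beta)=0$, $f>0$ on $D\cap(-\infty,-\beta)$ and $f<0$ on $D\cap(\beta,\infty)$. *Auxiliary function.* Let $V\in C^1(\mathbb R)\cap W^{2,\infty}(\mathbb R)$ satisfy $V(1)=1$, $V'(1)=0$, $|V'|\le K_1$ and $0\le V\le K_2$ with constants $K_1,K_2>0$, and $|V(z_1)-1|\le|V(z_2)-1|$ whenever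 $|z_1-1|\le|z_2-1|$. For $v\in\mathbb V_h$ with values in $D$ and $w\in\mathbb R$ put $g_h(v,w)=\exp(w)/\exp(\langle F(v),1\rangle)$. *Time levels.* Let $N\ge1$, $0=t_0<t_1<\dots<t_N$, $\tau_k=t_k-t_{k-1}$, and $r_k=\tau_k/\tau_{k-1}$ for $k\ge2$. Write $w^{n-\varsigma}=(1-\varsigma)w^n+\varsigma w^{n-1}$, $t_{n-\varsigma}=(1-\varsigma)t_n+\varsigma t_{n-1}$, $t_{k-1/2}=(t_k+t_{k-1})/2$ and $\omega_{1-\alpha}(s)=s^{-\alpha}/\Gamma(1-\alpha)$. *L2-1$_\sigma$ formula.* Put $$a^{(n)}_{n-k}=\frac1{\tau_k}\int_{t_{k-1}}^{\min\{t_k,t_{n-\varsigma}\}}\omega_{1-\alpha}(t_{n-\varsigma}-s)\,ds\quad(1\le k\le n),$$ $$b^{(n)}_{n-k}=\frac{2}{\tau_k(\tau_k+\tau_{k+1})}\int_{t_{k-1}}^{t_k}(s-t_{k-1/2})\,\omega_{1-\alpha}(t_{n-\varsigma}-s)\,ds\quad(1\le k\le n-1).$$ Let $B^{(1)}_0=a^{(1)}_0$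 and, for $n\ge2$, $B^{(n)}_0=a^{(n)}_0+b^{(n)}_1/r_n$, $B^{(n)}_{n-k}=a^{(n)}_{n-k}+b^{(n)}_{n-k+1}/r_k-b^{(n)}_{n-k}$ for $2\le k\le n-1$, and $B^{(n)}_{n-1}=a^{(n)}_{n-1}-b^{(n)}_{n-1}$. Set $\tilde{\mathbb D}^\alpha_\tau w^n=\sum_{k=1}^nB^{(n)}_{n-k}(w^k-w^{k-1})$. *Scheme.* A solution of the L2-1$_\sigma$-sESAV scheme consists of $\phi^n,\hat\phi^n\in\mathbb V_h$ and $R^n\in\mathbb R$ $(0\le n\le N)$, with arbitrary initial data $\phi^0,R^0$, such that $\hat\phi^0=\phi^0$ and the following holds, where $\hat\phi^{n-\varsigma}:=(1-\varsigma)\hat\phi^n+\varsigma\phi^{n-1}$ and $V^{n-\varsigma}:=V(g_h(\hat\phi^{n-\varsigma},R^{n-1}))$. 1. $\hat\phi^{1-\varsigma}$ takes its values in $D$ and $B^{(1)}_0(\hat\phi^1-\phi^0)=m\,(\varepsilon^2\Delta_h\hat\phi^{1-\varsigma}+f(\hat\phi^{1-\varsigma}))$. 2. For $2\le n\le N$,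 $\hat\phi^n=\min\{\max\{(1+r_n)\phi^{n-1}-r_n\phi^{n-2},-\beta\},\beta\}$ pointwise. 3. For $1\le n\le N$, $$\tilde{\mathbb D}^\alpha_\tau\phi^n=m\,\big(\varepsilon^2\Delta_h\phi^{n-\varsigma}+V^{n-\varsigma}f(\hat\phi^{n-\varsigma})-\kappa V^{n-\varsigma}(\phi^{n-\varsigma}-\hat\phi^{n-\varsigma})\big),$$ $$\frac{R^n-R^{n-1}}{\tau_n}=V^{n-\varsigma}\Big\langle -f(\hat\phi^{n-\varsigma})+\kappa(\phi^{n-\varsigma}-\hat\phi^{n-\varsigma}),\ \frac{\phi^n-\phi^{n-1}}{\tau_n}\Big\rangle.$$ **Theorem.** Assume that $\kappa\ge\max_{[-\beta,\beta]}|f'|$, that $r_k\ge 4/7$ for $2\le k\le N$, that $$\tau_1\le\Big(\frac{4}{11\,\varsigma\, m\,(\kappa+4\varepsilon^2/h^2)\,\Gamma(2-\alpha)}\Big)^{1/\alpha},\qquad \tau_1\le\Big(\frac{4}{11\,\kappa\,(1-\varsigma)\,m\,\Gamma(2-\alpha)}\Big)^{1/\alpha}$$ (the second bound being $+\infty$ if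 $\kappa=0$), and that $$\tau_n\le\Big(\frac{4}{11\,(1-\varsigma)\,m\,(4\varepsilon^2/h^2+\kappa K_2)\,\Gamma(2-\alpha)}\Big)^{1/\alpha}\qquad(1\le n\le N).$$ Then every solution of the L2-1$_\sigma$-sESAV scheme satisfies the discrete maximum bound principle: if $\|\phi^0\|_\infty\le\beta$, then $\|\phi^n\|_\infty\le\beta$ for all $1\le n\le N$. -/

import Mathlib

open scoped ContDiff

noncomputable section

namespace TFAC

/-! ### The auxiliary function -/

/-- `w` is the weak derivative of `u` on the real line. -/
def HasWeakDeriv (u w : ℝ → ℝ) : Prop :=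
  MeasureTheory.LocallyIntegrable u ∧ MeasureTheory.LocallyIntegrable w ∧
    ∀ ψ : ℝ → ℝ, ContDiff ℝ ∞ ψ → HasCompactSupport ψ →
      ∫ x, u x * deriv ψ x = -∫ x, w x * ψ x

/-- Membership in the Sobolev space `W^{2,∞}(ℝ)`. -/
def MemW2Infty (u : ℝ → ℝ) : Prop :=
  ∃ u₁ u₂ : ℝ → ℝ, HasWeakDeriv u u₁ ∧ HasWeakDeriv u₁ u₂ ∧
    MeasureTheory.MemLp u ⊤ ∧ MeasureTheory.MemLp u₁ ⊤ ∧ MeasureTheory.MemLp u₂ ⊤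

/-- The assumptions on the auxiliary function `V` with constants `K₁`, `K₂`. -/
structure IsAuxiliary (V : ℝ → ℝ) (K₁ K₂ : ℝ) : Prop where
  contDiff : ContDiff ℝ 1 V
  memW2Infty : MemW2Infty V
  map_one : V 1 = 1
  deriv_one : deriv V 1 = 0
  K₁_pos : 0 < K₁
  abs_deriv_le : ∀ z, |deriv V z| ≤ K₁
  K₂_pos : 0 < K₂
  nonneg : ∀ z, 0 ≤ V z
  le_K₂ : ∀ z, V z ≤ K₂
  monotone_dist : ∀ z₁ z₂, |z₁ - 1| ≤ |z₂ - 1| → |V z₁ - 1| ≤ |V z₂ - 1|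

/-! ### The potential -/

/-- `F` is a potential with `f = -F'` continuously differentiable on the domain `D` (all of `ℝ` for
the double-well potential, `(-1, 1)` for the Flory--Huggins potential); `f` vanishes at `±β` and has
the restoring sign in `D` outside `[-β, β]`. The values of `F` and `f` off `D` are irrelevant. -/
structure IsPotential (D : Set ℝ) (F f : ℝ → ℝ) (β : ℝ) : Prop where
  isOpen : IsOpen D
  Icc_subset : Set.Icc (-β) β ⊆ D
  hasDerivAt : ∀ x ∈ D, HasDerivAt F (-f x) x
  contDiffOn : ContDiffOn ℝ 1 f D
  β_pos : 0 < β
  map_β : f β = 0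
  map_neg_β : f (-β) = 0
  pos_of_lt : ∀ x ∈ D, x < -β → 0 < f x
  neg_of_gt : ∀ x ∈ D, β < x → f x < 0

/-- The norm of `C[a, b]` (a maximum when `u` is continuous on `[a, b]`). -/
def cNorm (u : ℝ → ℝ) (a b : ℝ) : ℝ := sSup ((fun x => |u x|) '' Set.Icc a b)

/-! ### Periodic grid functions on the square -/

/-- Grid functions that are `M`-periodic in both directions. The norm `‖v‖` that this type carries
is the maximum norm. -/
abbrev Grid (M : ℕ) : Type := ZMod M × ZMod M → ℝ

/-- The five-point Laplacian with mesh size `h`. -/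
def lap {M : ℕ} (h : ℝ) (v : Grid M) : Grid M := fun p =>
  1 / h ^ 2 * (v (p.1 + 1, p.2) + v (p.1 - 1, p.2) + v (p.1, p.2 + 1) + v (p.1, p.2 - 1) - 4 * v p)

/-- The discrete `L²` inner product. -/
def gridInner {M : ℕ} [NeZero M] (h : ℝ) (v w : Grid M) : ℝ := h ^ 2 * ∑ p, v p * w p

/-- `g_h(v, w) = exp w / exp ⟨F(v), 1⟩`. -/
def gFun {M : ℕ} [NeZero M] (h : ℝ) (F : ℝ → ℝ) (v : Grid M) (w : ℝ) : ℝ :=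
  Real.exp w / Real.exp (gridInner h (fun p => F (v p)) (fun _ => 1))

/-! ### The nonuniform L2-1σ formula -/

/-- The time step `τ_k = t_k - t_{k-1}`, for `k ≥ 1`. -/
def step (t : ℕ → ℝ) (k : ℕ) : ℝ := t k - t (k - 1)

/-- The step ratio `r_k = τ_k / τ_{k-1}`, for `k ≥ 2`. -/
def ratio (t : ℕ → ℝ) (k : ℕ) : ℝ := step t k / step t (k - 1)

/-- `ω_μ(s) = s^{μ-1} / Γ(μ)`. -/
def omega (μ s : ℝ) : ℝ := s ^ (μ - 1) / Real.Gamma μ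

/-- The weighted level `w^{n-σ} = (1 - σ) w^n + σ w^{n-1}`, for `n ≥ 1`; applied to `t` itself it is
the off-set time `t_{n-σ}`. -/
def offset {E : Type*} [AddCommGroup E] [Module ℝ E] (σ : ℝ) (w : ℕ → E) (n : ℕ) : E :=
  (1 - σ) • w n + σ • w (n - 1)

/-- The coefficient `a^{(n)}_{n-k}`, for `1 ≤ k ≤ n`, with `σ = α / 2`. -/
def aCoeff (α : ℝ) (t : ℕ → ℝ) (n k : ℕ) : ℝ :=
  1 / step t k * ∫ s in t (k - 1)..min (t k) (offset (α / 2) t n),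
    omega (1 - α) (offset (α / 2) t n - s)

/-- The coefficient `b^{(n)}_{n-k}`, for `1 ≤ k ≤ n - 1`, with `σ = α / 2`. -/
def bCoeff (α : ℝ) (t : ℕ → ℝ) (n k : ℕ) : ℝ :=
  2 / (step t k * (step t k + step t (k + 1))) * ∫ s in t (k - 1)..t k,
    (s - offset (1 / 2) t k) * omega (1 - α) (offset (α / 2) t n - s)

/-- The kernel `B^{(n)}_{n-k}`, for `1 ≤ k ≤ n`. -/
def kernelB (α : ℝ) (t : ℕ → ℝ) (n k : ℕ) : ℝ :=
  if n = 1 then aCoeff α t 1 1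
  else if k = n then aCoeff α t n n + bCoeff α t n (n - 1) / ratio t n
  else if k = 1 then aCoeff α t n 1 - bCoeff α t n 1
  else aCoeff α t n k + bCoeff α t n (k - 1) / ratio t k - bCoeff α t n k

/-- The discrete Caputo derivative `∑_{k=1}^n B^{(n)}_{n-k} (w^k - w^{k-1})`. -/
def caputo {M : ℕ} (α : ℝ) (t : ℕ → ℝ) (w : ℕ → Grid M) (n : ℕ) : Grid M :=
  ∑ k ∈ Finset.Icc 1 n, kernelB α t n k • (w k - w (k - 1))

/-! ### The scheme -/

/-- `φ̂^{n-σ} = (1 - σ) φ̂^n + σ φ^{n-1}`, with `σ = α / 2`. -/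
def hatOffset {M : ℕ} (α : ℝ) (φ φhat : ℕ → Grid M) (n : ℕ) : Grid M :=
  (1 - α / 2) • φhat n + (α / 2) • φ (n - 1)

/-- The scalar `V^{n-σ} = V(g_h(φ̂^{n-σ}, R^{n-1}))`. -/
def vCoeff {M : ℕ} [NeZero M] (α h : ℝ) (F V : ℝ → ℝ) (φ φhat : ℕ → Grid M) (R : ℕ → ℝ)
    (n : ℕ) : ℝ :=
  V (gFun h F (hatOffset α φ φhat n) (R (n - 1)))

/-- `(φ, φ̂, R)` solves the stabilized L2-1σ exponential SAV scheme on the time levels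
`t 0, …, t N`. From the second step on, `φ̂^n` is linear extrapolation cut off at `±β`. -/
structure IsSchemeSolution {M : ℕ} [NeZero M] (α m ε κ β h : ℝ) (D : Set ℝ) (F f V : ℝ → ℝ)
    (N : ℕ) (t : ℕ → ℝ) (φ φhat : ℕ → Grid M) (R : ℕ → ℝ) : Prop where
  hat_zero : φhat 0 = φ 0
  /-- The nonlinear equation for `φ̂¹` evaluates `f` within its domain. -/
  hat_one_mem : ∀ p, hatOffset α φ φhat 1 p ∈ D
  hat_one : kernelB α t 1 1 • (φhat 1 - φ 0) =
    m • (ε ^ 2 • lap h (hatOffset α φ φhat 1) + fun p => f (hatOffset α φ φhat 1 p))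
  hat_succ : ∀ n, 2 ≤ n → n ≤ N → φhat n = fun p =>
    min (max ((1 + ratio t n) * φ (n - 1) p - ratio t n * φ (n - 2) p) (-β)) β
  phase : ∀ n, 1 ≤ n → n ≤ N → caputo α t φ n =
    m • (ε ^ 2 • lap h (offset (α / 2) φ n)
      + vCoeff α h F V φ φhat R n • (fun p => f (hatOffset α φ φhat n p))
      - (κ * vCoeff α h F V φ φhat R n) • (offset (α / 2) φ n - hatOffset α φ φhat n))
  sav : ∀ n, 1 ≤ n → n ≤ N → (R n - R (n - 1)) / step t n =
    vCoeff α h F V φ φhat R n *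
      gridInner h
        (-(fun p => f (hatOffset α φ φhat n p))
          + κ • (offset (α / 2) φ n - hatOffset α φ φhat n))
        ((1 / step t n) • (φ n - φ (n - 1)))

end TFAC

end

/-! Induction over the time levels; the claim at level `n` is a discrete maximum principle. Let `B`
be the weight of the newest increment in the Caputo sum and `P` that of the increment before it (`P
= 0` if `n = 1`). Collecting the terms in `φ n` on one side makes the phase equation `(B + κWm(1-θ))
φⁿ - mε²(1-θ) Δφⁿ = [(B - P - κWmθ) φⁿ⁻¹ + mε²θ Δφⁿ⁻¹] - E + mW (f(u) + κu)`, with `θ = α/2`, `W`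
the value of `V`, `u` the predictor at the weighted level and `E` the older history. At an extremum
of `φⁿ` the Laplacian on the left has a favourable sign, so it is enough to bound the right side by
`(B + κWm(1-θ)) β`. The three contributions are bounded by `(B - P - κWmθ) β`, `P β` and `mWκ β`,
which add up to exactly that.

The history bound is summation by parts against a kernel that increases towards the present. This
monotonicity comes from squeezing each older weight between the values of `ω_{1-α}(T - s)` at the
two ends of its interval (`omega_le_kernelB`, `kernelB_le_omega`); the ratio bound `4/7` serves the
upper half. The explicit bracket needs `B - P - κWmθ ≥ 4mε²θ/h²`, which follows from `(1-2θ) B ≥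
(1-θ) P` (`one_sub_half_mul_kernelB_pred_le`) and the step-size bound (`abs_le_of_phase_eq`). The
nonlinear term is bounded because `f(x) + κx` is monotone on `[-β, β]`, provided `u` stays there: by
the sign of `f` outside `[-β, β]` at the first step, by the cut-off afterwards. -/

namespace TFAC

open MeasureTheory intervalIntegral

/-! ### Monotone convex functions on an interval -/

section Interval

variable {w : ℝ → ℝ} {a b : ℝ}

theorem integral_sub_midpoint_mul_const (a b c : ℝ) :
    ∫ s in a..b, (s - (a + b) / 2) * c = 0 := by
  rw [intervalIntegral.integral_mul_const,
    intervalIntegral.integral_sub (by simp) (by simp)]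
  simp only [integral_id, intervalIntegral.integral_const, smul_eq_mul]
  ring

/-- The first moment about the midpoint does not see constants, so `w` may be normalised at
whichever point fixes the sign of the integrand. -/
theorem integral_sub_midpoint_mul_eq (hw : ContinuousOn w (Set.Icc a b)) (hab : a ≤ b) (c : ℝ) :
    ∫ s in a..b, (s - (a + b) / 2) * w s = ∫ s in a..b, (s - (a + b) / 2) * (w s - c) := by
  have h1 : IntervalIntegrable (fun s => (s - (a + b) / 2) * w s) volume a b := by
    apply ContinuousOn.intervalIntegrable
    rw [Set.uIcc_of_le hab]
    fun_prop
  have h2 : IntervalIntegrable (fun s : ℝ => (s - (a + b) / 2) * c) volume a b := by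
    apply Continuous.intervalIntegrable
    fun_prop
  simp only [mul_sub _ (w _) c]
  rw [intervalIntegral.integral_sub h1 h2, integral_sub_midpoint_mul_const, sub_zero]

theorem integral_sub_midpoint_mul_nonneg (hw : ContinuousOn w (Set.Icc a b)) (hab : a ≤ b)
    (hm : MonotoneOn w (Set.Icc a b)) : 0 ≤ ∫ s in a..b, (s - (a + b) / 2) * w s := by
  rw [integral_sub_midpoint_mul_eq hw hab (w ((a + b) / 2))]
  apply intervalIntegral.integral_nonneg hab
  intro s hs
  have hc : (a + b) / 2 ∈ Set.Icc a b := ⟨by linarith, by linarith⟩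
  rcases le_total s ((a + b) / 2) with h | h
  · exact mul_nonneg_of_nonpos_of_nonpos (by linarith) (sub_nonpos.2 (hm hs hc h))
  · exact mul_nonneg (by linarith) (sub_nonneg.2 (hm hc hs h))

/-- Since `c ≥ b - a`, the factor `1 - (2/c)(s - (a+b)/2)` is nonnegative on `[a, b]`; integrate it
against `w - w a ≥ 0`. With `c = τ_k + τ_{k+1}` the moment term becomes the coefficient `b`. -/
theorem left_add_le_average (hw : ContinuousOn w (Set.Icc a b)) (hab : a < b)
    (hm : MonotoneOn w (Set.Icc a b)) {c : ℝ} (hc : b - a ≤ c) :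
    w a + 2 / ((b - a) * c) * ∫ s in a..b, (s - (a + b) / 2) * w s
      ≤ 1 / (b - a) * ∫ s in a..b, w s := by
  have hτ : 0 < b - a := sub_pos.2 hab
  have hc0 : 0 < c := hτ.trans_le hc
  have h0 : 0 ≤ ∫ s in a..b, (w s - w a) * (1 - 2 / c * (s - (a + b) / 2)) := by
    apply intervalIntegral.integral_nonneg hab.le
    intro s hs
    refine mul_nonneg (sub_nonneg.2 (hm ⟨le_rfl, hab.le⟩ hs hs.1)) ?_
    rw [sub_nonneg, div_mul_eq_mul_div, div_le_one hc0]
    linarith [hs.2]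
  have hi1 : IntervalIntegrable w volume a b := by
    apply ContinuousOn.intervalIntegrable
    rwa [Set.uIcc_of_le hab.le]
  have hi2 : IntervalIntegrable (fun s => (s - (a + b) / 2) * (w s - w a)) volume a b := by
    apply ContinuousOn.intervalIntegrable
    rw [Set.uIcc_of_le hab.le]
    fun_prop
  have h1 : ∫ s in a..b, (w s - w a) * (1 - 2 / c * (s - (a + b) / 2)) =
      ((∫ s in a..b, w s) - (b - a) * w a)
        - 2 / c * ∫ s in a..b, (s - (a + b) / 2) * w s := by
    rw [integral_sub_midpoint_mul_eq hw hab.le (w a), ← intervalIntegral.integral_const_mul]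
    have : ∫ s in a..b, (w s - w a) = (∫ s in a..b, w s) - (b - a) * w a := by
      rw [intervalIntegral.integral_sub hi1 (by simp)]
      simp
    rw [← this, ← intervalIntegral.integral_sub (hi1.sub (by simp)) (hi2.const_mul _)]
    congr 1
    ext s
    ring
  rw [h1] at h0
  have e : 1 / (b - a) * (∫ s in a..b, w s) - (w a + 2 / ((b - a) * c) *
      ∫ s in a..b, (s - (a + b) / 2) * w s) = 1 / (b - a) * (((∫ s in a..b, w s) - (b - a) * w a)
        - 2 / c * ∫ s in a..b, (s - (a + b) / 2) * w s) := by
    field_simp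
    ring
  have := mul_nonneg (by positivity : 0 ≤ 1 / (b - a)) h0
  linarith

/-- Comparison with the line of slope `q` through the midpoint value, whose moment is `q ∫ (s -
(a+b)/2)² ds`. -/
theorem integral_sub_midpoint_mul_le (hw : ContinuousOn w (Set.Icc a b)) (hab : a ≤ b) {q : ℝ}
    (hq : ∀ x ∈ Set.Icc a b, ∀ y ∈ Set.Icc a b, x ≤ y → w y - w x ≤ q * (y - x)) :
    ∫ s in a..b, (s - (a + b) / 2) * w s ≤ q * (b - a) ^ 3 / 12 := by
  rw [integral_sub_midpoint_mul_eq hw hab (w ((a + b) / 2))]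
  have h : ∫ s in a..b, (s - (a + b) / 2) * (q * (s - (a + b) / 2)) = q * (b - a) ^ 3 / 12 := by
    have : ∀ s : ℝ, (s - (a + b) / 2) * (q * (s - (a + b) / 2)) = q * (s - (a + b) / 2) ^ 2 := by
      intro s; ring
    simp only [this]
    rw [intervalIntegral.integral_const_mul,
      intervalIntegral.integral_comp_sub_right (fun x => x ^ 2), integral_pow]
    ring
  rw [← h]
  apply intervalIntegral.integral_mono_on hab
  · apply ContinuousOn.intervalIntegrable
    rw [Set.uIcc_of_le hab]
    fun_prop
  · apply Continuous.intervalIntegrable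
    fun_prop
  intro s hs
  have hc : (a + b) / 2 ∈ Set.Icc a b := ⟨by linarith, by linarith⟩
  rcases le_total s ((a + b) / 2) with h | h
  · exact mul_le_mul_of_nonpos_left (by linarith [hq s hs _ hc h]) (by linarith)
  · exact mul_le_mul_of_nonneg_left (hq _ hc s hs h) (by linarith)

theorem average_add_le_right (hw : ContinuousOn w (Set.Icc a b)) (hab : a < b) {q : ℝ}
    (hq : ∀ x ∈ Set.Icc a b, q * (b - x) ≤ w b - w x) :
    1 / (b - a) * (∫ s in a..b, w s) + q * (b - a) / 2 ≤ w b := by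
  have hτ : 0 < b - a := sub_pos.2 hab
  have h : ∫ s in a..b, w s ≤ ∫ s in a..b, (w b - q * (b - s)) := by
    apply intervalIntegral.integral_mono_on hab.le
    · apply ContinuousOn.intervalIntegrable
      rwa [Set.uIcc_of_le hab.le]
    · apply Continuous.intervalIntegrable
      fun_prop
    · intro s hs
      linarith [hq s hs]
  have e : ∫ s in a..b, (w b - q * (b - s)) = (b - a) * w b - q * (b - a) ^ 2 / 2 := by
    rw [intervalIntegral.integral_sub (by simp) (by apply Continuous.intervalIntegrable; fun_prop),
      intervalIntegral.integral_const_mul, intervalIntegral.integral_comp_sub_left (fun x => x)]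
    simp
    ring
  rw [e] at h
  have h2 := mul_le_mul_of_nonneg_left h (by positivity : 0 ≤ 1 / (b - a))
  have e2 : 1 / (b - a) * ((b - a) * w b - q * (b - a) ^ 2 / 2) = w b - q * (b - a) / 2 := by
    field_simp
  linarith

end Interval

/-! ### The weight `ω_{1-α}(T - s)` -/

section Weight

variable {α T : ℝ}

theorem continuousOn_omega_sub : ContinuousOn (fun s => omega (1 - α) (T - s)) (Set.Iio T) := by
  intro s hs
  have : T - s ≠ 0 := (sub_pos.2 hs).ne'
  apply ContinuousAt.continuousWithinAt
  unfold omega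
  exact (ContinuousAt.rpow_const (by fun_prop) (Or.inl this)).div_const _

theorem hasDerivAt_omega_sub {s : ℝ} (hs : s < T) :
    HasDerivAt (fun s => omega (1 - α) (T - s))
      (α * (T - s) ^ (-α - 1) / Real.Gamma (1 - α)) s := by
  have h := ((hasDerivAt_id s).const_sub T).rpow_const (p := 1 - α - 1)
    (Or.inl (sub_pos.2 hs).ne')
  have e : -1 * (1 - α - 1) * (T - id s) ^ (1 - α - 1 - 1) = α * (T - s) ^ (-α - 1) := by
    rw [show 1 - α - 1 - 1 = -α - 1 by ring, id]
    ring
  exact e ▸ h.div_const (Real.Gamma (1 - α))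

theorem omega_sub_nonneg (hα1 : α < 1) {s : ℝ} (hs : s ≤ T) : 0 ≤ omega (1 - α) (T - s) :=
  div_nonneg (Real.rpow_nonneg (sub_nonneg.2 hs) _) (Real.Gamma_pos_of_pos (by linarith)).le

theorem omega_sub_sub_le (hα0 : 0 < α) (hα1 : α < 1) {c x y : ℝ} (hc : c < T) (hxy : x ≤ y)
    (hy : y ≤ c) : omega (1 - α) (T - y) - omega (1 - α) (T - x)
      ≤ α * (T - c) ^ (-α - 1) / Real.Gamma (1 - α) * (y - x) := by
  have hΓ : 0 < Real.Gamma (1 - α) := Real.Gamma_pos_of_pos (by linarith)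
  refine Convex.image_sub_le_mul_sub_of_deriv_le (convex_Iic c)
    (f := fun s => omega (1 - α) (T - s)) ?_ ?_ ?_ x (hxy.trans hy) y hy hxy
  · exact continuousOn_omega_sub.mono fun s hs => lt_of_le_of_lt hs hc
  · rw [interior_Iic]
    exact fun s hs => (hasDerivAt_omega_sub (hs.trans hc)).differentiableAt.differentiableWithinAt
  · rw [interior_Iic]
    intro s hs
    rw [(hasDerivAt_omega_sub (hs.trans hc)).deriv]
    have hs' : s < c := hs
    have := Real.rpow_le_rpow_of_nonpos (sub_pos.2 hc) (by linarith : T - c ≤ T - s)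
      (by linarith : -α - 1 ≤ 0)
    gcongr

theorem le_omega_sub_sub (hα0 : 0 < α) (hα1 : α < 1) {c x y : ℝ} (hcx : c ≤ x) (hxy : x ≤ y)
    (hy : y < T) : α * (T - c) ^ (-α - 1) / Real.Gamma (1 - α) * (y - x)
      ≤ omega (1 - α) (T - y) - omega (1 - α) (T - x) := by
  have hΓ : 0 < Real.Gamma (1 - α) := Real.Gamma_pos_of_pos (by linarith)
  refine Convex.mul_sub_le_image_sub_of_le_deriv (convex_Icc c y)
    (f := fun s => omega (1 - α) (T - s)) ?_ ?_ ?_ x ⟨hcx, hxy⟩ y ⟨hcx.trans hxy, le_rfl⟩ hxy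
  · exact continuousOn_omega_sub.mono fun s hs => lt_of_le_of_lt hs.2 hy
  · rw [interior_Icc]
    exact fun s hs =>
      (hasDerivAt_omega_sub (hs.2.trans hy)).differentiableAt.differentiableWithinAt
  · rw [interior_Icc]
    intro s hs
    rw [(hasDerivAt_omega_sub (hs.2.trans hy)).deriv]
    have := Real.rpow_le_rpow_of_nonpos (sub_pos.2 (hs.2.trans hy))
      (by linarith [hs.1] : T - s ≤ T - c) (by linarith : -α - 1 ≤ 0)
    gcongr

theorem monotoneOn_omega_sub (hα0 : 0 < α) (hα1 : α < 1) :
    MonotoneOn (fun s => omega (1 - α) (T - s)) (Set.Iio T) := by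
  intro x hx y hy hxy
  have h := le_omega_sub_sub hα0 hα1 le_rfl hxy hy
  have hΓ : 0 < Real.Gamma (1 - α) := Real.Gamma_pos_of_pos (by linarith)
  have : 0 ≤ α * (T - x) ^ (-α - 1) / Real.Gamma (1 - α) * (y - x) :=
    mul_nonneg (div_nonneg (mul_nonneg hα0.le
      (Real.rpow_nonneg (sub_nonneg.2 (le_of_lt hx)) _)) hΓ.le) (by linarith)
  exact sub_nonneg.1 (this.trans h)

theorem integral_omega_sub (hα1 : α < 1) {a : ℝ} :
    ∫ s in a..T, omega (1 - α) (T - s) = (T - a) ^ (1 - α) / Real.Gamma (2 - α) := by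
  rw [intervalIntegral.integral_comp_sub_left (fun x => omega (1 - α) x)]
  unfold omega
  have h1 : (1 - α) ≠ 0 := by linarith
  have h2 : Real.Gamma (2 - α) = (1 - α) * Real.Gamma (1 - α) := by
    rw [← Real.Gamma_add_one h1]; congr 1; ring
  rw [intervalIntegral.integral_div, integral_rpow (Or.inl (by linarith)), h2, sub_self,
    sub_add_cancel, Real.zero_rpow h1, sub_zero, div_div]

end Weight
end TFAC

namespace TFAC

/-! ### The kernel of the L2-1σ formula -/

section Kernel

variable {α : ℝ} {t : ℕ → ℝ} {n : ℕ}

theorem offset_sub_self (t : ℕ → ℝ) (n : ℕ) (σ : ℝ) :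
    offset σ t n - t (n - 1) = (1 - σ) * step t n := by
  simp only [offset, step, smul_eq_mul]
  ring

theorem le_of_forall_pred_lt (ht : ∀ k, 1 ≤ k → k ≤ n → t (k - 1) < t k) {j k : ℕ}
    (hjk : j ≤ k) (hk : k ≤ n) : t j ≤ t k := by
  induction k, hjk using Nat.le_induction with
  | base => exact le_rfl
  | succ k _ ih =>
    have := ht (k + 1) (by omega) hk
    rw [Nat.add_sub_cancel] at this
    exact (ih (by omega)).trans this.le

theorem lt_offset (hα1 : α < 1) (ht : ∀ k, 1 ≤ k → k ≤ n → t (k - 1) < t k) {k : ℕ}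
    (hk : k < n) : t k < offset (α / 2) t n := by
  have h1 := le_of_forall_pred_lt ht (show k ≤ n - 1 by omega) (by omega)
  have h2 := offset_sub_self t n (α / 2)
  have h3 : 0 < (1 - α / 2) * step t n :=
    mul_pos (by linarith) (sub_pos.2 (ht n (by omega) le_rfl))
  linarith

theorem continuousOn_omega_Icc (hα1 : α < 1) (ht : ∀ k, 1 ≤ k → k ≤ n → t (k - 1) < t k) {k : ℕ}
    (hk : k < n) : ContinuousOn (fun s => omega (1 - α) (offset (α / 2) t n - s))
      (Set.Icc (t (k - 1)) (t k)) :=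
  continuousOn_omega_sub.mono fun _ hs => lt_of_le_of_lt hs.2 (lt_offset hα1 ht hk)

theorem monotoneOn_omega_Icc (hα0 : 0 < α) (hα1 : α < 1)
    (ht : ∀ k, 1 ≤ k → k ≤ n → t (k - 1) < t k) {k : ℕ} (hk : k < n) :
    MonotoneOn (fun s => omega (1 - α) (offset (α / 2) t n - s)) (Set.Icc (t (k - 1)) (t k)) :=
  (monotoneOn_omega_sub hα0 hα1).mono fun _ hs => lt_of_le_of_lt hs.2 (lt_offset hα1 ht hk)

/-! ### Bounds for the coefficients `a` and `b` on the older intervals -/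

theorem bCoeff_eq (α : ℝ) (t : ℕ → ℝ) (n k : ℕ) :
    bCoeff α t n k = 2 / ((t k - t (k - 1)) * (step t k + step t (k + 1))) *
      ∫ s in t (k - 1)..t k, (s - (t (k - 1) + t k) / 2) *
        omega (1 - α) (offset (α / 2) t n - s) := by
  have : offset (1 / 2) t k = (t (k - 1) + t k) / 2 := by
    simp only [offset, smul_eq_mul]
    ring
  rw [bCoeff, this, step]

theorem aCoeff_of_lt (hα1 : α < 1) (ht : ∀ k, 1 ≤ k → k ≤ n → t (k - 1) < t k) {k : ℕ}
    (hk : k < n) : aCoeff α t n k = 1 / (t k - t (k - 1)) *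
      ∫ s in t (k - 1)..t k, omega (1 - α) (offset (α / 2) t n - s) := by
  rw [aCoeff, min_eq_left (lt_offset hα1 ht hk).le, step]

theorem bCoeff_nonneg (hα0 : 0 < α) (hα1 : α < 1) (ht : ∀ k, 1 ≤ k → k ≤ n → t (k - 1) < t k)
    {k : ℕ} (hk1 : 1 ≤ k) (hk : k < n) : 0 ≤ bCoeff α t n k := by
  have h1 := ht k hk1 hk.le
  have h2 := ht (k + 1) (by omega) hk
  rw [bCoeff_eq]
  refine mul_nonneg (div_nonneg two_pos.le (mul_nonneg (by linarith) ?_))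
    (integral_sub_midpoint_mul_nonneg (continuousOn_omega_Icc hα1 ht hk) h1.le
      (monotoneOn_omega_Icc hα0 hα1 ht hk))
  simp only [step]
  linarith

theorem omega_add_bCoeff_le_aCoeff (hα0 : 0 < α) (hα1 : α < 1)
    (ht : ∀ k, 1 ≤ k → k ≤ n → t (k - 1) < t k) {k : ℕ} (hk1 : 1 ≤ k) (hk : k < n) :
    omega (1 - α) (offset (α / 2) t n - t (k - 1)) + bCoeff α t n k ≤ aCoeff α t n k := by
  have h2 := ht (k + 1) (by omega) hk
  rw [aCoeff_of_lt hα1 ht hk, bCoeff_eq]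
  refine left_add_le_average (continuousOn_omega_Icc hα1 ht hk) (ht k hk1 hk.le)
    (monotoneOn_omega_Icc hα0 hα1 ht hk) ?_
  simp only [step]
  linarith

theorem aCoeff_le_omega (hα0 : 0 < α) (hα1 : α < 1)
    (ht : ∀ k, 1 ≤ k → k ≤ n → t (k - 1) < t k) {k : ℕ} (hk1 : 1 ≤ k) (hk : k < n) :
    aCoeff α t n k ≤ omega (1 - α) (offset (α / 2) t n - t k) := by
  rw [aCoeff_of_lt hα1 ht hk]
  have h1 := ht k hk1 hk.le
  have h := average_add_le_right (q := 0) (continuousOn_omega_Icc hα1 ht hk) h1 ?_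
  · simpa using h
  · intro x hx
    rw [zero_mul, sub_nonneg]
    exact monotoneOn_omega_Icc hα0 hα1 ht hk hx ⟨h1.le, le_rfl⟩ hx.2

/-- By convexity, the slope `q` of the weight at the common node `t_{k-1}` is the largest slope on
the interval before it and the smallest on the interval after it. It therefore bounds `b` on the
former from above and, on the latter, the gap between the average `a` and the right end value from
below. -/
theorem aCoeff_add_bCoeff_div_ratio_le (hα0 : 0 < α) (hα1 : α < 1)
    (ht : ∀ k, 1 ≤ k → k ≤ n → t (k - 1) < t k) {k : ℕ} (hk1 : 2 ≤ k) (hk : k < n)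
    (hr : 4 / 7 ≤ ratio t k) :
    aCoeff α t n k + bCoeff α t n (k - 1) / ratio t k
      ≤ omega (1 - α) (offset (α / 2) t n - t k) := by
  have h1 := ht k (by omega) hk.le
  have h0 := ht (k - 1) (by omega) (by omega)
  have hk' : k - 1 < n := by omega
  have hc := lt_offset hα1 ht hk'
  obtain ⟨q, hqdef⟩ : ∃ q, q = α * (offset (α / 2) t n - t (k - 1)) ^ (-α - 1)
    / Real.Gamma (1 - α) := ⟨_, rfl⟩
  have hq0 : 0 ≤ q := by
    rw [hqdef]
    exact div_nonneg (mul_nonneg hα0.le (Real.rpow_nonneg (by linarith) _))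
      (Real.Gamma_pos_of_pos (by linarith)).le
  have hA := average_add_le_right (q := q) (continuousOn_omega_Icc hα1 ht hk) h1 fun x hx => by
    rw [hqdef]
    exact le_omega_sub_sub hα0 hα1 hx.1 hx.2 (lt_offset hα1 ht hk)
  have hS := integral_sub_midpoint_mul_le (q := q) (continuousOn_omega_Icc hα1 ht hk') h0.le
    fun x hx y hy hxy => by
      rw [hqdef]
      exact omega_sub_sub_le hα0 hα1 hc hxy hy.2
  rw [aCoeff_of_lt hα1 ht hk, bCoeff_eq, show k - 1 + 1 = k by omega]
  unfold ratio at hr ⊢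
  simp only [step] at hr ⊢
  refine le_trans (add_le_add_right ?_ _) hA
  generalize (∫ s in t (k - 1 - 1)..t (k - 1), (s - (t (k - 1 - 1) + t (k - 1)) / 2) *
        omega (1 - α) (offset (α / 2) t n - s)) = S at hS ⊢
  obtain ⟨x, hx⟩ : ∃ x, x = t (k - 1) - t (k - 1 - 1) := ⟨_, rfl⟩
  obtain ⟨y, hy⟩ : ∃ y, y = t k - t (k - 1) := ⟨_, rfl⟩
  rw [← hx, ← hy] at hr ⊢
  rw [← hx] at hS
  have hx0 : 0 < x := by linarith
  have hy0 : 0 < y := by linarith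
  rw [le_div_iff₀ hx0] at hr
  calc 2 / (x * (x + y)) * S / (y / x)
      ≤ 2 / (x * (x + y)) * (q * x ^ 3 / 12) / (y / x) := by gcongr
    _ = q * (x ^ 3 / (6 * (x + y) * y)) := by field_simp; ring
    _ ≤ q * (y / 2) := by
        -- With `x = τ_{k-1}` and `y = τ_k` this is `x³ ≤ 3(x + y)y²`, which holds with room to
        -- spare for `x ≤ 7y/4`.
        refine mul_le_mul_of_nonneg_left ?_ hq0
        rw [div_le_div_iff₀ (by positivity) two_pos]
        have hxy : x ≤ 7 / 4 * y := by linarith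
        have h3 : x ^ 2 ≤ (7 / 4 * y) ^ 2 := by gcongr
        have h4 : x * x ^ 2 ≤ x * (7 / 4 * y) ^ 2 := by gcongr
        have h5 : x * y ^ 2 ≤ 7 / 4 * y * y ^ 2 := by gcongr
        nlinarith [mul_pos hx0 (mul_pos hy0 hy0), mul_pos hy0 (mul_pos hy0 hy0)]
    _ = q * y / 2 := by ring

/-! ### The coefficient `a` on the newest interval -/

theorem aCoeff_self (hα0 : 0 < α) (hα1 : α < 1) (hn : t (n - 1) < t n) :
    aCoeff α t n n =
      (1 - α / 2) ^ (1 - α) * step t n ^ (-α) / Real.Gamma (2 - α) := by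
  have hτ : 0 < step t n := sub_pos.2 hn
  have hT : offset (α / 2) t n ≤ t n := by
    have h1 := offset_sub_self t n (α / 2)
    have h2 : 0 ≤ α / 2 * step t n := by positivity
    simp only [step] at h1 h2
    linarith
  rw [aCoeff, min_eq_right hT, integral_omega_sub hα1, offset_sub_self,
    Real.mul_rpow (by linarith) hτ.le, sub_eq_add_neg 1 α, Real.rpow_add hτ, Real.rpow_one]
  field_simp

/-- Integrating the power gives an exact identity. It ties the newest weight to the value of `ω`
that bounds the preceding weight from above, and `1 - α = 1 - 2σ` because `σ = α/2`. -/
theorem one_sub_mul_aCoeff_self (hα0 : 0 < α) (hα1 : α < 1) (hn : t (n - 1) < t n) :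
    (1 - α) * aCoeff α t n n =
      (1 - α / 2) * omega (1 - α) (offset (α / 2) t n - t (n - 1)) := by
  have hτ : 0 < step t n := sub_pos.2 hn
  have h1 : (1 - α) ≠ 0 := by linarith
  have h2 : Real.Gamma (2 - α) = (1 - α) * Real.Gamma (1 - α) := by
    rw [← Real.Gamma_add_one h1]; congr 1; ring
  have hθ : 0 < 1 - α / 2 := by linarith
  have hΓ : Real.Gamma (1 - α) ≠ 0 := (Real.Gamma_pos_of_pos (by linarith)).ne'
  rw [aCoeff_self hα0 hα1 hn, omega, offset_sub_self, show 1 - α - 1 = -α by ring,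
    Real.mul_rpow hθ.le hτ.le, h2, sub_eq_add_neg 1 α, Real.rpow_add hθ, Real.rpow_one,
    ← sub_eq_add_neg]
  field_simp

theorem half_mul_rpow_le_aCoeff_self (hα0 : 0 < α) (hα1 : α < 1) (hn : t (n - 1) < t n) :
    1 / 2 * step t n ^ (-α) / Real.Gamma (2 - α) ≤ aCoeff α t n n := by
  have hτ : 0 < step t n := sub_pos.2 hn
  have hΓ : 0 < Real.Gamma (2 - α) := Real.Gamma_pos_of_pos (by linarith)
  rw [aCoeff_self hα0 hα1 hn]
  -- A base in `(0, 1]` grows when the exponent drops from `1` to `1 - α`; the base itself exceeds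
  -- `1/2`.
  have : 1 - α / 2 ≤ (1 - α / 2) ^ (1 - α) := by
    conv_lhs => rw [← Real.rpow_one (1 - α / 2)]
    exact Real.rpow_le_rpow_of_exponent_ge (by linarith) (by linarith) (by linarith)
  have h2 : 1 / 2 ≤ (1 - α / 2) ^ (1 - α) := by linarith
  gcongr

/-! ### Two-sided bounds and monotonicity of the kernel `B` -/

theorem aCoeff_self_le_kernelB (hα0 : 0 < α) (hα1 : α < 1)
    (ht : ∀ k, 1 ≤ k → k ≤ n → t (k - 1) < t k) (hn : 1 ≤ n) :
    aCoeff α t n n ≤ kernelB α t n n := by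
  unfold kernelB
  by_cases h : n = 1
  · rw [if_pos h, h]
  · rw [if_neg h, if_pos rfl]
    have h1 := bCoeff_nonneg hα0 hα1 ht (k := n - 1) (by omega) (by omega)
    have h2 : 0 < ratio t n :=
      div_pos (sub_pos.2 (ht n hn le_rfl)) (sub_pos.2 (ht (n - 1) (by omega) (by omega)))
    have := div_nonneg h1 h2.le
    linarith

theorem kernelB_le_omega (hα0 : 0 < α) (hα1 : α < 1)
    (ht : ∀ k, 1 ≤ k → k ≤ n → t (k - 1) < t k)
    (hr : ∀ k, 2 ≤ k → k ≤ n → 4 / 7 ≤ ratio t k) {k : ℕ} (hk1 : 1 ≤ k) (hk : k < n) :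
    kernelB α t n k ≤ omega (1 - α) (offset (α / 2) t n - t k) := by
  have hb := bCoeff_nonneg hα0 hα1 ht hk1 hk
  rw [kernelB, if_neg (by omega), if_neg (by omega)]
  split_ifs with h
  · subst h
    linarith [aCoeff_le_omega hα0 hα1 ht hk1 hk]
  · linarith [aCoeff_add_bCoeff_div_ratio_le hα0 hα1 ht (by omega) hk (hr k (by omega) hk.le)]

theorem omega_le_kernelB (hα0 : 0 < α) (hα1 : α < 1)
    (ht : ∀ k, 1 ≤ k → k ≤ n → t (k - 1) < t k) {k : ℕ} (hk1 : 1 ≤ k) (hk : k < n) :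
    omega (1 - α) (offset (α / 2) t n - t (k - 1)) ≤ kernelB α t n k := by
  have hb := omega_add_bCoeff_le_aCoeff hα0 hα1 ht hk1 hk
  rw [kernelB, if_neg (by omega), if_neg (by omega)]
  split_ifs with h
  · subst h
    linarith
  · have h1 := bCoeff_nonneg hα0 hα1 ht (k := k - 1) (by omega) (by omega)
    have h2 : 0 < ratio t k :=
      div_pos (sub_pos.2 (ht k hk1 hk.le)) (sub_pos.2 (ht (k - 1) (by omega) (by omega)))
    have := div_nonneg h1 h2.le
    linarith

theorem kernelB_nonneg (hα0 : 0 < α) (hα1 : α < 1)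
    (ht : ∀ k, 1 ≤ k → k ≤ n → t (k - 1) < t k) {k : ℕ} (hk1 : 1 ≤ k) (hk : k < n) :
    0 ≤ kernelB α t n k :=
  (omega_sub_nonneg hα1 (lt_offset hα1 ht (show k - 1 < n by omega)).le).trans
    (omega_le_kernelB hα0 hα1 ht hk1 hk)

/-- The value of `ω` at the shared node `t_k` separates the two weights. -/
theorem kernelB_le_succ (hα0 : 0 < α) (hα1 : α < 1)
    (ht : ∀ k, 1 ≤ k → k ≤ n → t (k - 1) < t k)
    (hr : ∀ k, 2 ≤ k → k ≤ n → 4 / 7 ≤ ratio t k) {k : ℕ} (hk1 : 1 ≤ k) (hk : k + 1 < n) :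
    kernelB α t n k ≤ kernelB α t n (k + 1) :=
  (kernelB_le_omega hα0 hα1 ht hr hk1 (by omega)).trans
    (omega_le_kernelB hα0 hα1 ht (k := k + 1) (by omega) hk)

/-- The property `(1 - 2σ) B₀ ≥ (1 - σ) B₁`, which is stronger than `B₀ ≥ B₁`. -/
theorem one_sub_half_mul_kernelB_pred_le (hα0 : 0 < α) (hα1 : α < 1)
    (ht : ∀ k, 1 ≤ k → k ≤ n → t (k - 1) < t k)
    (hr : ∀ k, 2 ≤ k → k ≤ n → 4 / 7 ≤ ratio t k) (hn : 2 ≤ n) :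
    (1 - α / 2) * kernelB α t n (n - 1) ≤ (1 - α) * kernelB α t n n :=
  calc (1 - α / 2) * kernelB α t n (n - 1)
      ≤ (1 - α / 2) * omega (1 - α) (offset (α / 2) t n - t (n - 1)) :=
        mul_le_mul_of_nonneg_left
          (kernelB_le_omega hα0 hα1 ht hr (by omega) (by omega)) (by linarith)
    _ = (1 - α) * aCoeff α t n n :=
        (one_sub_mul_aCoeff_self hα0 hα1 (ht n (by omega) le_rfl)).symm
    _ ≤ (1 - α) * kernelB α t n n :=
        mul_le_mul_of_nonneg_left
          (aCoeff_self_le_kernelB hα0 hα1 ht (by omega)) (by linarith)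

end Kernel
end TFAC

namespace TFAC

/-! ### Summation by parts -/

/-- By Abel summation the quantity inside the absolute value is minus a combination of `x 0, …, x (j
- 1)` with the nonnegative weights `B 1, B 2 - B 1, …, B j - B (j - 1)`, which sum to `B j`. -/
theorem abs_sum_mul_sub_sub_le {B x : ℕ → ℝ} {β : ℝ} {j : ℕ} (hj : 1 ≤ j)
    (hB1 : 0 ≤ B 1) (hB : ∀ k, 1 ≤ k → k < j → B k ≤ B (k + 1)) (hx : ∀ k, k < j → |x k| ≤ β) :
    |∑ k ∈ Finset.Icc 1 j, B k * (x k - x (k - 1)) - B j * x j| ≤ B j * β := by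
  induction j, hj using Nat.le_induction with
  | base =>
    simp only [Finset.Icc_self, Finset.sum_singleton, Nat.sub_self]
    rw [show B 1 * (x 1 - x 0) - B 1 * x 1 = -(B 1 * x 0) by ring, abs_neg, abs_mul,
      abs_of_nonneg hB1]
    exact mul_le_mul_of_nonneg_left (hx 0 one_pos) hB1
  | succ j hj ih =>
    have ih' := ih (fun k h1 h2 => hB k h1 (by omega)) (fun k hk => hx k (by omega))
    have hd : 0 ≤ B (j + 1) - B j := sub_nonneg.2 (hB j hj (by omega))
    have h2 : |(B (j + 1) - B j) * x j| ≤ (B (j + 1) - B j) * β := by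
      rw [abs_mul, abs_of_nonneg hd]
      exact mul_le_mul_of_nonneg_left (hx j (by omega)) hd
    rw [Finset.sum_Icc_succ_top (by omega), Nat.add_sub_cancel,
      show (∑ k ∈ Finset.Icc 1 j, B k * (x k - x (k - 1))) + B (j + 1) * (x (j + 1) - x j)
          - B (j + 1) * x (j + 1)
        = (∑ k ∈ Finset.Icc 1 j, B k * (x k - x (k - 1)) - B j * x j)
          - (B (j + 1) - B j) * x j by ring]
    refine (abs_sub _ _).trans ?_
    linarith

/-- The discrete Caputo derivative isolates its two latest levels; the remaining history is
controlled by a bound on the earlier levels. -/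
theorem exists_caputo_eq {α : ℝ} (hα0 : 0 < α) (hα1 : α < 1) {t : ℕ → ℝ} {n : ℕ} (hn : 1 ≤ n)
    (ht : ∀ k, 1 ≤ k → k ≤ n → t (k - 1) < t k)
    (hr : ∀ k, 2 ≤ k → k ≤ n → 4 / 7 ≤ ratio t k) {M : ℕ} {φ : ℕ → Grid M} {β : ℝ}
    (hφ : ∀ k, k < n → ∀ p, |φ k p| ≤ β) :
    ∃ (P : ℝ) (E : Grid M), α / 2 * kernelB α t n n ≤ (1 - α / 2) * (kernelB α t n n - P) ∧
      (∀ p, |E p| ≤ P * β) ∧ ∀ p, caputo α t φ n p =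
        kernelB α t n n * φ n p - (kernelB α t n n - P) * φ (n - 1) p + E p := by
  have hc : ∀ p, caputo α t φ n p =
      ∑ k ∈ Finset.Icc 1 n, kernelB α t n k * (φ k p - φ (k - 1) p) := fun p => by
    simp [caputo, Finset.sum_apply]
  have hB0 : 0 ≤ kernelB α t n n := by
    have hτ : 0 < step t n := sub_pos.2 (ht n hn le_rfl)
    have hΓ : 0 < Real.Gamma (2 - α) := Real.Gamma_pos_of_pos (by linarith)
    refine le_trans ?_ ((half_mul_rpow_le_aCoeff_self hα0 hα1 (ht n hn le_rfl)).trans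
      (aCoeff_self_le_kernelB hα0 hα1 ht hn))
    positivity
  obtain rfl | hn2 : n = 1 ∨ 2 ≤ n := by omega
  -- The first step has no history; the inequality reduces to `α/2 ≤ 1 - α/2`.
  · refine ⟨0, 0, ?_, by simp, fun p => ?_⟩
    · rw [sub_zero]
      exact mul_le_mul_of_nonneg_right (by linarith) hB0
    · rw [hc]
      simp
      ring
  · refine ⟨kernelB α t n (n - 1), fun p => ∑ k ∈ Finset.Icc 1 (n - 1),
      kernelB α t n k * (φ k p - φ (k - 1) p) - kernelB α t n (n - 1) * φ (n - 1) p,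
      ?_, fun p => ?_, fun p => ?_⟩
    · linarith [one_sub_half_mul_kernelB_pred_le hα0 hα1 ht hr hn2]
    · exact abs_sum_mul_sub_sub_le (B := kernelB α t n) (x := fun k => φ k p) (by omega)
        (kernelB_nonneg hα0 hα1 ht le_rfl (by omega))
        (fun k h1 h2 => kernelB_le_succ hα0 hα1 ht hr h1 (by omega))
        (fun k hk => hφ k (by omega) p)
    · rw [hc]
      obtain ⟨j, rfl⟩ : ∃ j, n = j + 1 := ⟨n - 1, by omega⟩
      rw [Finset.sum_Icc_succ_top (by omega), Nat.add_sub_cancel]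
      ring

/-! ### The maximum principle for the five-point Laplacian -/

section Laplacian

variable {M : ℕ} {h : ℝ}

theorem lap_nonpos_of_forall_le {v : Grid M} {p : ZMod M × ZMod M} (hp : ∀ q, v q ≤ v p) :
    lap h v p ≤ 0 := by
  refine mul_nonpos_of_nonneg_of_nonpos (by positivity) ?_
  linarith [hp (p.1 + 1, p.2), hp (p.1 - 1, p.2), hp (p.1, p.2 + 1), hp (p.1, p.2 - 1)]

theorem lap_neg (v : Grid M) : lap h (-v) = -lap h v := by
  ext p
  simp only [lap, Pi.neg_apply]
  ring

theorem lap_add_smul (a b : ℝ) (v w : Grid M) (p : ZMod M × ZMod M) :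
    lap h (a • v + b • w) p = a * lap h v p + b * lap h w p := by
  simp only [lap, Pi.add_apply, Pi.smul_apply, smul_eq_mul]
  ring

theorem exists_forall_le [NeZero M] (v : Grid M) : ∃ p, ∀ q, v q ≤ v p :=
  Finite.exists_max v

theorem le_of_mul_sub_lap_le [NeZero M] {A e β : ℝ} (hA : 0 < A) (he : 0 ≤ e) {v : Grid M}
    (hv : ∀ p, A * v p - e * lap h v p ≤ A * β) (p : ZMod M × ZMod M) : v p ≤ β := by
  obtain ⟨q, hq⟩ := exists_forall_le v
  have h1 := mul_nonpos_of_nonneg_of_nonpos he (lap_nonpos_of_forall_le (h := h) hq)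
  exact (hq p).trans (le_of_mul_le_mul_left (by linarith [hv q]) hA)

theorem abs_le_of_abs_mul_sub_lap_le [NeZero M] {A e β : ℝ} (hA : 0 < A) (he : 0 ≤ e) {v : Grid M}
    (hv : ∀ p, |A * v p - e * lap h v p| ≤ A * β) (p : ZMod M × ZMod M) : |v p| ≤ β := by
  rw [abs_le]
  constructor
  · have := le_of_mul_sub_lap_le (h := h) (v := -v) (β := β) hA he (fun q => ?_) p
    · simp only [Pi.neg_apply] at this
      linarith
    · rw [lap_neg]
      simp only [Pi.neg_apply]
      linarith [(abs_le.1 (hv q)).1]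
  · exact le_of_mul_sub_lap_le hA he (fun q => (abs_le.1 (hv q)).2) p

/-- The condition on `c` keeps the weight of the central value nonnegative; the neighbours have
weight `e/h²` each, and all five weights sum to `c`. -/
theorem abs_mul_add_lap_le {c e β : ℝ} (he : 0 ≤ e) (hc : 4 * e / h ^ 2 ≤ c) {v : Grid M}
    (hv : ∀ p, |v p| ≤ β) (p : ZMod M × ZMod M) : |c * v p + e * lap h v p| ≤ c * β := by
  have e1 : c * v p + e * lap h v p = (c - 4 * e / h ^ 2) * v p + e / h ^ 2 *
      (v (p.1 + 1, p.2) + v (p.1 - 1, p.2) + v (p.1, p.2 + 1) + v (p.1, p.2 - 1)) := by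
    simp only [lap]
    ring
  have h1 : |(c - 4 * e / h ^ 2) * v p| ≤ (c - 4 * e / h ^ 2) * β := by
    rw [abs_mul, abs_of_nonneg (sub_nonneg.2 hc)]
    exact mul_le_mul_of_nonneg_left (hv p) (sub_nonneg.2 hc)
  have h0 : 0 ≤ e / h ^ 2 := by positivity
  have h2 : |e / h ^ 2 *
      (v (p.1 + 1, p.2) + v (p.1 - 1, p.2) + v (p.1, p.2 + 1) + v (p.1, p.2 - 1))|
      ≤ e / h ^ 2 * (4 * β) := by
    rw [abs_mul, abs_of_nonneg h0]
    refine mul_le_mul_of_nonneg_left ?_ h0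
    have a1 := abs_le.1 (hv (p.1 + 1, p.2))
    have a2 := abs_le.1 (hv (p.1 - 1, p.2))
    have a3 := abs_le.1 (hv (p.1, p.2 + 1))
    have a4 := abs_le.1 (hv (p.1, p.2 - 1))
    rw [abs_le]
    constructor <;> linarith
  rw [e1]
  refine (abs_add_le _ _).trans ((add_le_add h1 h2).trans (le_of_eq ?_))
  ring

end Laplacian

/-! ### The stabilized nonlinearity -/

section Potential

variable {D : Set ℝ} {F f : ℝ → ℝ} {β κ : ℝ}

theorem IsPotential.abs_deriv_le (hF : IsPotential D F f β) (hκ : cNorm (deriv f) (-β) β ≤ κ)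
    {x : ℝ} (hx : x ∈ Set.Icc (-β) β) : |deriv f x| ≤ κ := by
  refine le_trans (le_csSup ?_ (Set.mem_image_of_mem (fun y => |deriv f y|) hx)) hκ
  refine (isCompact_Icc.image_of_continuousOn ?_).bddAbove
  exact ((hF.contDiffOn.continuousOn_deriv_of_isOpen hF.isOpen le_rfl).mono hF.Icc_subset).abs

theorem IsPotential.nonneg_of_cNorm_le (hF : IsPotential D F f β)
    (hκ : cNorm (deriv f) (-β) β ≤ κ) : 0 ≤ κ :=
  (abs_nonneg _).trans
    (hF.abs_deriv_le hκ (x := β) ⟨by linarith [hF.β_pos], le_rfl⟩)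

/-- Since `|f'| ≤ κ`, the function `f(y) + κy` is nondecreasing on `[-β, β]`, and its end values are
`±κβ` because `f` vanishes there. -/
theorem IsPotential.abs_add_mul_le (hF : IsPotential D F f β)
    (hκ : cNorm (deriv f) (-β) β ≤ κ) {x : ℝ} (hx : x ∈ Set.Icc (-β) β) :
    |f x + κ * x| ≤ κ * β := by
  have hβ := hF.β_pos
  have hd : ∀ y ∈ Set.Icc (-β) β, DifferentiableAt ℝ f y := fun y hy =>
    (hF.contDiffOn.differentiableOn one_ne_zero).differentiableAt
      (hF.isOpen.mem_nhds (hF.Icc_subset hy))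
  have hm : MonotoneOn (fun y => f y + κ * y) (Set.Icc (-β) β) := by
    apply monotoneOn_of_deriv_nonneg (convex_Icc _ _)
    · exact fun y hy => ((hd y hy).continuousAt.add (by fun_prop)).continuousWithinAt
    · intro y hy
      exact ((hd y (interior_subset hy)).add (by fun_prop)).differentiableWithinAt
    · intro y hy
      have h1 := ((hd y (interior_subset hy)).hasDerivAt.add
        ((hasDerivAt_id y).const_mul κ)).deriv
      have h2 := (abs_le.1 (hF.abs_deriv_le hκ (interior_subset hy))).1
      have h3 : deriv (fun y => f y + κ * y) y = deriv f y + κ * 1 := h1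
      rw [h3]
      linarith
  have h1 := hm ⟨le_rfl, by linarith⟩ hx hx.1
  have h2 := hm hx ⟨by linarith, le_rfl⟩ hx.2
  simp only [hF.map_β, hF.map_neg_β] at h1 h2
  rw [abs_le]
  constructor <;> linarith

end Potential

/-! ### The discrete maximum bound principle -/

/-- The implicit equation for the first predictor keeps its weighted level in `[-β, β]`. -/
theorem abs_le_of_mul_sub_eq {M : ℕ} [NeZero M] {h c m e β : ℝ} {D : Set ℝ} {F f : ℝ → ℝ}
    (hF : IsPotential D F f β) (hc : 0 < c) (hm : 0 < m) (he : 0 ≤ e) {u v : Grid M}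
    (hu : ∀ p, u p ∈ D) (hv : ∀ p, |v p| ≤ β)
    (huv : ∀ p, c * (u p - v p) = m * (e * lap h u p + f (u p))) (p : ZMod M × ZMod M) :
    |u p| ≤ β := by
  rw [abs_le]
  constructor
  · obtain ⟨q, hq⟩ := exists_forall_le (-u)
    have hl := mul_nonpos_of_nonneg_of_nonpos he (lap_nonpos_of_forall_le (h := h) hq)
    rw [lap_neg] at hl
    simp only [Pi.neg_apply] at hq hl
    refine le_trans ?_ (neg_le_neg_iff.1 (hq p))
    -- At a minimum below `-β` both the Laplacian term and `f` push upwards, forcing `u q > v q ≥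
    -- -β`.
    by_contra! hlt
    have h1 := hF.pos_of_lt _ (hu q) hlt
    have h2 : 0 < c * (u q - v q) := by
      rw [huv]
      exact mul_pos hm (by linarith)
    have h3 := (mul_pos_iff_of_pos_left hc).1 h2
    linarith [(abs_le.1 (hv q)).1]
  · obtain ⟨q, hq⟩ := exists_forall_le u
    have hl := mul_nonpos_of_nonneg_of_nonpos he (lap_nonpos_of_forall_le (h := h) hq)
    refine (hq p).trans ?_
    by_contra! hlt
    have h1 := hF.neg_of_gt _ (hu q) hlt
    have h2 : 0 < c * (v q - u q) := by
      have := mul_neg_of_pos_of_neg hm (show e * lap h u q + f (u q) < 0 by linarith)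
      linarith [huv q]
    have h3 := (mul_pos_iff_of_pos_left hc).1 h2
    linarith [(abs_le.1 (hv q)).2]

/-- One step of the scheme preserves the maximum bound. -/
theorem abs_le_of_phase_eq {M : ℕ} [NeZero M] {θ h B P m e κ W β : ℝ} {x y E g u : Grid M}
    (hθ0 : 0 ≤ θ) (hθ1 : θ < 1) (hB : 0 < B) (hm : 0 ≤ m) (he : 0 ≤ e) (hκ : 0 ≤ κ) (hW : 0 ≤ W)
    (hP : θ * B ≤ (1 - θ) * (B - P))
    (hτ : (1 - θ) * m * (4 * e / h ^ 2 + κ * W) ≤ B)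
    (hE : ∀ p, |E p| ≤ P * β) (hy : ∀ p, |y p| ≤ β) (hg : ∀ p, |g p + κ * u p| ≤ κ * β)
    (heq : ∀ p, B * x p - (B - P) * y p + E p =
      m * (e * lap h ((1 - θ) • x + θ • y) p + W * g p
        - κ * W * ((1 - θ) * x p + θ * y p - u p)))
    (p : ZMod M × ZMod M) : |x p| ≤ β := by
  have hθ : 0 < 1 - θ := by linarith
  -- Multiply the step-size condition by `θ`, insert it into `hP` and cancel `1 - θ`. This is what
  -- makes the explicit part at level `n - 1` a combination with nonnegative weights.
  have hBP : θ * m * (4 * e / h ^ 2 + κ * W) ≤ B - P := by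
    have h1 : (1 - θ) * (θ * m * (4 * e / h ^ 2 + κ * W)) ≤ (1 - θ) * (B - P) := by
      refine le_trans ?_ hP
      have := mul_le_mul_of_nonneg_left hτ hθ0
      linarith
    exact le_of_mul_le_mul_left h1 hθ
  refine abs_le_of_abs_mul_sub_lap_le (h := h) (A := B + κ * W * m * (1 - θ))
    (e := m * e * (1 - θ)) (by positivity) (by positivity) (fun p => ?_) p
  have h1 := abs_mul_add_lap_le (h := h) (e := m * e * θ) (c := B - P - κ * W * m * θ)
    (by positivity) (by
      have : 4 * (m * e * θ) / h ^ 2 = θ * m * (4 * e / h ^ 2) := by ring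
      rw [this]
      linarith) hy p
  have h2 : |m * W * (g p + κ * u p)| ≤ m * W * (κ * β) := by
    rw [abs_mul, abs_of_nonneg (by positivity)]
    exact mul_le_mul_of_nonneg_left (hg p) (by positivity)
  have e1 := heq p
  rw [lap_add_smul] at e1
  have e2 : (B + κ * W * m * (1 - θ)) * x p - m * e * (1 - θ) * lap h x p =
      ((B - P - κ * W * m * θ) * y p + m * e * θ * lap h y p) - E p
        + m * W * (g p + κ * u p) := by
    linarith
  rw [e2]
  have h3 := abs_le.1 h1
  have h4 := abs_le.1 h2
  have h5 := abs_le.1 (hE p)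
  rw [abs_le]
  -- The bounds add up exactly: `(B - P - κWmθ) + P + mWκ = B + κWm(1 - θ)`.
  constructor <;> linarith

/-- Turns a step-size restriction into a lower bound for the newest weight. The restriction gives
the factor `4/11`, which is below the `1/2` of `half_mul_rpow_le_aCoeff_self`. -/
theorem le_half_mul_rpow_neg {α X G τ : ℝ} (hα : 0 < α) (hX : 0 < X) (hG : 0 < G) (hτ : 0 < τ)
    (h : τ ≤ (4 / (11 * X * G)) ^ (1 / α)) : X ≤ 1 / 2 * τ ^ (-α) / G := by
  have h1 : τ ^ α ≤ 4 / (11 * X * G) := by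
    have := Real.rpow_le_rpow hτ.le h hα.le
    rwa [← Real.rpow_mul (by positivity), one_div_mul_cancel hα.ne', Real.rpow_one] at this
  have h2 : 0 < τ ^ α := Real.rpow_pos_of_pos hτ _
  rw [le_div_iff₀ (by positivity)] at h1
  rw [Real.rpow_neg hτ.le, le_div_iff₀ hG, ← div_eq_mul_inv, le_div_iff₀ h2]
  nlinarith [mul_pos (mul_pos hX hG) h2]

end TFAC
theorem mainTheorem3 {M : ℕ} [NeZero M]
    (α m ε κ β L h K₁ K₂ : ℝ) (D : Set ℝ) (F f V : ℝ → ℝ)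
    (N : ℕ) (t : ℕ → ℝ) (φ φhat : ℕ → TFAC.Grid M) (R : ℕ → ℝ)
    (hα0 : 0 < α) (hα1 : α < 1) (hm : 0 < m) (hε : 0 < ε)
    (hL : 0 < L) (hh : h = L / M)
    (hF : TFAC.IsPotential D F f β) (hV : TFAC.IsAuxiliary V K₁ K₂)
    (hκ : TFAC.cNorm (deriv f) (-β) β ≤ κ)
    (hN : 1 ≤ N) (ht0 : t 0 = 0) (ht : ∀ k, 1 ≤ k → k ≤ N → t (k - 1) < t k)
    (hr : ∀ k, 2 ≤ k → k ≤ N → 4 / 7 ≤ TFAC.ratio t k)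
    (hτ₁ : TFAC.step t 1 ≤
      (4 / (11 * (α / 2) * m * (κ + 4 * ε ^ 2 / h ^ 2) * Real.Gamma (2 - α))) ^ (1 / α))
    -- for `κ = 0` the second first-step bound is infinite, that is, void
    (hτ₁' : κ ≠ 0 → TFAC.step t 1 ≤
      (4 / (11 * κ * (1 - α / 2) * m * Real.Gamma (2 - α))) ^ (1 / α))
    (hτ : ∀ n, 1 ≤ n → n ≤ N → TFAC.step t n ≤
      (4 / (11 * (1 - α / 2) * m * (4 * ε ^ 2 / h ^ 2 + κ * K₂) * Real.Gamma (2 - α))) ^ (1 / α))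
    (hsol : TFAC.IsSchemeSolution α m ε κ β h D F f V N t φ φhat R) :
    ‖φ 0‖ ≤ β → ∀ n, 1 ≤ n → n ≤ N → ‖φ n‖ ≤ β := by
  intro h0
  have hβ := hF.β_pos
  have hκ0 := hF.nonneg_of_cNorm_le hκ
  have hK := hV.K₂_pos
  have hh0 : 0 < h := by
    rw [hh]
    exact div_pos hL (Nat.cast_pos.2 (NeZero.pos M))
  have hΓ : 0 < Real.Gamma (2 - α) := Real.Gamma_pos_of_pos (by linarith)
  have hθ : 0 < 1 - α / 2 := by linarith
  have hiff : ∀ v : TFAC.Grid M, ‖v‖ ≤ β ↔ ∀ p, |v p| ≤ β := fun v => by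
    rw [pi_norm_le_iff_of_nonneg hβ.le]
    rfl
  simp only [hiff] at h0 ⊢
  suffices H : ∀ n, n ≤ N → ∀ p, |φ n p| ≤ β from fun n _ hn => H n hn
  intro n
  induction n using Nat.strong_induction_on with
  | _ n ih =>
  intro hn
  rcases Nat.eq_zero_or_pos n with rfl | hn1
  · exact h0
  have ht' : ∀ k, 1 ≤ k → k ≤ n → t (k - 1) < t k := fun k h1 h2 => ht k h1 (h2.trans hn)
  have hr' : ∀ k, 2 ≤ k → k ≤ n → 4 / 7 ≤ TFAC.ratio t k := fun k h1 h2 => hr k h1 (h2.trans hn)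
  have hφ : ∀ k, k < n → ∀ p, |φ k p| ≤ β := fun k hk => ih k hk (by omega)
  have hstep : 0 < TFAC.step t n := sub_pos.2 (ht' n hn1 le_rfl)
  have hBτ : (1 - α / 2) * m * (4 * ε ^ 2 / h ^ 2 + κ * K₂) ≤ TFAC.kernelB α t n n := by
    refine ((TFAC.le_half_mul_rpow_neg hα0 (by positivity) hΓ hstep ?_).trans
      (TFAC.half_mul_rpow_le_aCoeff_self hα0 hα1 (ht' n hn1 le_rfl))).trans
      (TFAC.aCoeff_self_le_kernelB hα0 hα1 ht' hn1)
    convert hτ n hn1 hn using 3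
    ring
  have hB : 0 < TFAC.kernelB α t n n := lt_of_lt_of_le (by positivity) hBτ
  have hhat : ∀ p, |TFAC.hatOffset α φ φhat n p| ≤ β := by
    obtain rfl | hn2 : n = 1 ∨ 2 ≤ n := by omega
    -- The weighted predictor differs from `φ 0` by `(1 - α/2)(φhat 1 - φ 0)`, so dividing the
    -- kernel by `1 - α/2` gives a fully implicit equation for the weighted level alone.
    · refine TFAC.abs_le_of_mul_sub_eq (h := h) (c := TFAC.kernelB α t 1 1 / (1 - α / 2))
        (e := ε ^ 2) hF (by positivity) hm (by positivity) hsol.hat_one_mem h0 fun p => ?_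
      have h1 := congrFun hsol.hat_one p
      simp only [Pi.smul_apply, Pi.sub_apply, Pi.add_apply, smul_eq_mul] at h1
      rw [← h1]
      simp only [TFAC.hatOffset, Pi.smul_apply, Pi.add_apply, smul_eq_mul, Nat.sub_self]
      rw [show (1 - α / 2) * φhat 1 p + α / 2 * φ 0 p - φ 0 p = (1 - α / 2) * (φhat 1 p - φ 0 p) by
        ring, ← mul_assoc, div_mul_cancel₀ _ hθ.ne']
    -- From the second step on, the weighted level is a convex combination of the cut-off predictor
    -- and `φ (n - 1)`.
    · intro p
      have h1 : |φhat n p| ≤ β := by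
        rw [hsol.hat_succ n hn2 hn, abs_le]
        exact ⟨le_min (le_max_right _ _) (by linarith), min_le_right _ _⟩
      have h2 := abs_le.1 (hφ (n - 1) (by omega) p)
      have h3 := abs_le.1 h1
      simp only [TFAC.hatOffset, Pi.smul_apply, Pi.add_apply, smul_eq_mul]
      rw [abs_le]
      constructor <;> nlinarith
  obtain ⟨P, E, hP, hE, hc⟩ := TFAC.exists_caputo_eq hα0 hα1 hn1 ht' hr' hφ
  have hVn := hV.le_K₂ (TFAC.gFun h F (TFAC.hatOffset α φ φhat n) (R (n - 1)))
  refine TFAC.abs_le_of_phase_eq (h := h) (e := ε ^ 2)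
    (W := TFAC.vCoeff α h F V φ φhat R n) (y := φ (n - 1))
    (g := fun p => f (TFAC.hatOffset α φ φhat n p)) (u := TFAC.hatOffset α φ φhat n)
    (by positivity) (by linarith) hB hm.le (by positivity) hκ0 (hV.nonneg _) hP
    (le_trans ?_ hBτ) hE (hφ _ (by omega))
    (fun p => hF.abs_add_mul_le hκ (abs_le.1 (hhat p))) fun p => ?_
  · have : TFAC.vCoeff α h F V φ φhat R n ≤ K₂ := hVn
    gcongr
  · rw [← hc, hsol.phase n hn1 hn]
    simp only [TFAC.offset, Pi.smul_apply, Pi.add_apply, Pi.sub_apply, smul_eq_mul]
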